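/- Let $G$ be a Lie group with unit $e$ and Lie algebra $\mathfrak g=T_eG$, $\dim G=n$; write $l_g$ for the left shift by $g$. Let a left-invariant (sub-)Riemannian metric on $G$ be given by a subspace $\mathfrak p\subseteq\mathfrak g$ which generates the Lie algebra $\mathfrak g$ and a scalar product $\langle\cdot,\cdot\rangle$ on $\mathfrak p$ (the metric is Riemannian if $\mathfrak p=\mathfrak g$); put $|v|=\sqrt{\langle v,v\rangle}$ and $U=\{v\in\mathfrak p:|v|\le 1\}$. Let $\{e_1,\dots,e_n\}$ be a basis of $\mathfrak g$ whose first $r$ vectors form an orthonormal basis of $\mathfrak p$, and let $c_{ij}^k$ be the structure constants, $[e_i,e_j]=\sum_k c_{ij}^k e_k$. A curve $g:\mathbb R\to G$ is called an extremal if it satisfies the Pontryagin maximum principle for the time-optimal problem $\dot g=dl_g(u)$, $u\in U$: there are a measurable control $\bar u:\mathbb R\to U$ and a nowhere vanishing, locally absolutely continuous covector function $\psi(t)\in T^*_{g(t)}G$ along $g$ such that, with $H(g,\psi,u)=\psi(dl_g(u))$, the curve $(g,\psi)$ is a Carathéodory solution of the Hamiltonian system $\dot g=\partial H/\partial\psi$,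 $\dot\psi=-\partial H/\partial g$ with control $\bar u$ (in canonical coordinates of $T^*G$), and $H(g(t),\psi(t),\bar u(t))=\max_{u\in U}H(g(t),\psi(t),u)$ for almost all $t$. Put $M_0=\max_{u\in U}H(g(0),\psi(0),u)$. The extremal is normal if $M_0>0$; normal extremals are the normal geodesics parameterized by arc length. Let $g(t)$, $t\in\mathbb R$, be a normal geodesic parameterized by arc length with $g(0)=e$, with control $\bar u$ and covector function $\psi$ as above. Put $\psi_j(t)=M_0^{-1}\,\psi(t)\bigl(dl_{g(t)}e_j\bigr)$, $j=1,\dots,n$ (so $\psi_j$ are the components of the left-translated covector, normalised to $M_0=1$), and $u(t)=\sum_{i=1}^r\psi_i(t)e_i$. Then $\bar u=u$ almost everywhere, $|u(0)|=1$, and for all $t\in\mathbb R$ and $j=1,\dots,n$ $$\dot g(t)=dl_{g(t)}u(t),\qquad \dot\psi_j(t)=\sum_{k=1}^n\sum_{i=1}^r c_{ij}^k\,\psi_i(t)\psi_k(t).$$ In the Riemannian case $r=n$. -/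

import Mathlib

open scoped Manifold ContDiff
open MeasureTheory

noncomputable section

/-- `LieGroup I ∞ G` gives the regularity under which Mathlib builds the Lie algebra of `G`. -/
instance lieGroupMinSmoothnessThree {E : Type*} [NormedAddCommGroup E] [NormedSpace ℝ E]
    {G : Type*} [TopologicalSpace G] [ChartedSpace E G] [Group G] [LieGroup 𝓘(ℝ, E) ∞ G] :
    LieGroup 𝓘(ℝ, E) (minSmoothness ℝ 3) G :=
  LieGroup.of_le (m := minSmoothness ℝ 3) (n := ∞) (by
    rw [minSmoothness_of_isRCLikeNormedField]
    exact ENat.LEInfty.out)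

/-- A left-invariant (sub-)Riemannian metric on a Lie group `G` with Lie algebra `𝔤 = T_e G`:
a subspace `𝔭 ⊆ 𝔤` generating `𝔤` as a Lie algebra, with a scalar product on `𝔭`.
The metric is Riemannian when `𝔭 = 𝔤`. -/
structure LeftInvSubRiemannianMetric (E : Type*) [NormedAddCommGroup E] [NormedSpace ℝ E]
    [FiniteDimensional ℝ E] (G : Type*) [TopologicalSpace G] [ChartedSpace E G] [Group G]
    [LieGroup 𝓘(ℝ, E) ∞ G] where
  /-- the subspace `𝔭` -/
  horizontal : Submodule ℝ (GroupLieAlgebra 𝓘(ℝ, E) G)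
  generates : LieSubalgebra.lieSpan ℝ (GroupLieAlgebra 𝓘(ℝ, E) G)
    (horizontal : Set (GroupLieAlgebra 𝓘(ℝ, E) G)) = ⊤
  /-- the scalar product on `𝔭` -/
  scalar : LinearMap.BilinForm ℝ horizontal
  scalar_symm : ∀ v w, scalar v w = scalar w v
  scalar_pos : ∀ v, v ≠ 0 → 0 < scalar v v

namespace LeftInvSubRiemannianMetric

variable {E : Type*} [NormedAddCommGroup E] [NormedSpace ℝ E] [FiniteDimensional ℝ E]
  {G : Type*} [TopologicalSpace G] [ChartedSpace E G] [Group G] [LieGroup 𝓘(ℝ, E) ∞ G]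

/-- The norm `|v| = √⟨v, v⟩` on `𝔭`. -/
def norm (m : LeftInvSubRiemannianMetric E G) (v : m.horizontal) : ℝ :=
  Real.sqrt (m.scalar v v)

/-- The control region `U`, the closed unit ball of `𝔭`. -/
def controlRegion (m : LeftInvSubRiemannianMetric E G) : Set m.horizontal :=
  {v | m.norm v ≤ 1}

end LeftInvSubRiemannianMetric

section Hamiltonian

variable {E : Type*} [NormedAddCommGroup E] [NormedSpace ℝ E]
  {G : Type*} [TopologicalSpace G] [ChartedSpace E G] [Group G]

/-- The Hamiltonian `H(g, ξ, w) = ξ (dl_g w)` of the control system `ġ = dl_g u`, for a covector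
`ξ ∈ T*_g G` and `w ∈ 𝔤`. Here `mulInvariantVectorField w g` is `dl_g w ∈ T_g G`. -/
def hamiltonian (g : G) (ξ : TangentSpace 𝓘(ℝ, E) g →L[ℝ] ℝ)
    (w : GroupLieAlgebra 𝓘(ℝ, E) G) : ℝ :=
  ξ (mulInvariantVectorField w g)

/-- The momentum coordinates of a covector `ξ ∈ T*_g G` in the canonical coordinates `(x, p)` of
`T*G` induced by the preferred chart `φ` of `G` at `c`, i.e. `p = ξ ∘ (dφ_g)⁻¹`. -/
def momentumCoord (c g : G) (ξ : TangentSpace 𝓘(ℝ, E) g →L[ℝ] ℝ) : E →L[ℝ] ℝ :=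
  ξ ∘L (mfderiv 𝓘(ℝ, E) 𝓘(ℝ, E) (extChartAt 𝓘(ℝ, E) c) g).inverse

/-- The Hamiltonian in the canonical coordinates `(x, p)` of `T*G` induced by the preferred chart `φ` of `G`
at `c`: the point is `φ⁻¹ x` and the covector at that point is `p ∘ dφ`. -/
def coordHamiltonian (c : G) (w : GroupLieAlgebra 𝓘(ℝ, E) G) (x : E) (p : E →L[ℝ] ℝ) : ℝ :=
  hamiltonian ((extChartAt 𝓘(ℝ, E) c).symm x)
    (p ∘L mfderiv 𝓘(ℝ, E) 𝓘(ℝ, E) (extChartAt 𝓘(ℝ, E) c) ((extChartAt 𝓘(ℝ, E) c).symm x)) w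

/-- The Hamiltonian system `ġ = ∂H/∂ψ`, `ψ̇ = -∂H/∂g` for the curve `(g, ψ)` in `T*G` and the
control `u`, in the sense of Carathéodory: on every compact time interval on which `g` stays in
the domain of a chart, the coordinates `(x, p)` of `(g, ψ)` are absolutely continuous and satisfy
`ẋ = ∂H/∂p`, `ṗ = -∂H/∂x` almost everywhere (the first equation is tested against all `q` in the
dual of the coordinate space). -/
def IsHamiltonianTrajectory (g : ℝ → G) (ψ : ∀ t, TangentSpace 𝓘(ℝ, E) (g t) →L[ℝ] ℝ)
    (u : ℝ → GroupLieAlgebra 𝓘(ℝ, E) G) : Prop :=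
  Continuous g ∧
  ∀ (c : G) (a b : ℝ), a ≤ b → (∀ t ∈ Set.Icc a b, g t ∈ (extChartAt 𝓘(ℝ, E) c).source) →
    AbsolutelyContinuousOnInterval (fun s ↦ extChartAt 𝓘(ℝ, E) c (g s)) a b ∧
    AbsolutelyContinuousOnInterval (fun s ↦ momentumCoord c (g s) (ψ s)) a b ∧
    ∀ᵐ t ∂(volume : Measure ℝ), t ∈ Set.Icc a b →
      (∀ q : E →L[ℝ] ℝ, HasDerivAt (fun s ↦ q (extChartAt 𝓘(ℝ, E) c (g s)))
        (fderiv ℝ (fun p ↦ coordHamiltonian c (u t) (extChartAt 𝓘(ℝ, E) c (g t)) p)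
          (momentumCoord c (g t) (ψ t)) q) t) ∧
      HasDerivAt (fun s ↦ momentumCoord c (g s) (ψ s))
        (-fderiv ℝ (fun x ↦ coordHamiltonian c (u t) x (momentumCoord c (g t) (ψ t)))
          (extChartAt 𝓘(ℝ, E) c (g t))) t

end Hamiltonian

namespace LeftInvSubRiemannianMetric

variable {E : Type*} [NormedAddCommGroup E] [NormedSpace ℝ E] [FiniteDimensional ℝ E]
  {G : Type*} [TopologicalSpace G] [ChartedSpace E G] [Group G] [LieGroup 𝓘(ℝ, E) ∞ G]

/-- The maximum of `H(g, ξ, ·)` over the control region (attained, `U` being compact). -/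
def maxHamiltonian (m : LeftInvSubRiemannianMetric E G) (g : G)
    (ξ : TangentSpace 𝓘(ℝ, E) g →L[ℝ] ℝ) : ℝ :=
  sSup ((fun w : m.horizontal ↦ hamiltonian g ξ (w : GroupLieAlgebra 𝓘(ℝ, E) G)) ''
    m.controlRegion)

/-- The curve `g` satisfies the Pontryagin maximum principle for the time-optimal problem
`ġ = dl_g u`, `u ∈ U`, with the measurable control `u` and the nowhere vanishing absolutely
continuous covector function `ψ` along `g`. Such a curve is an extremal. -/
structure IsExtremal (m : LeftInvSubRiemannianMetric E G) (g : ℝ → G)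
    (ψ : ∀ t, TangentSpace 𝓘(ℝ, E) (g t) →L[ℝ] ℝ) (u : ℝ → m.horizontal) : Prop where
  measurable : AEStronglyMeasurable u (volume : Measure ℝ)
  mem_region : ∀ t, u t ∈ m.controlRegion
  nonvanishing : ∀ t, ψ t ≠ 0
  hamiltonian_system :
    IsHamiltonianTrajectory g ψ (fun t ↦ (u t : GroupLieAlgebra 𝓘(ℝ, E) G))
  maximum : ∀ᵐ t ∂(volume : Measure ℝ),
    hamiltonian (g t) (ψ t) (u t : GroupLieAlgebra 𝓘(ℝ, E) G) = m.maxHamiltonian (g t) (ψ t)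

/-- A normal extremal: the maximised Hamiltonian, which is constant along every extremal, is
positive (the constancy is not part of the definition, only the value at time `0` is used).
With the control region the unit ball of `𝔭`, normal extremals are parameterized by arc length;
they are the normal geodesics parameterized by arc length. -/
structure IsNormalGeodesic (m : LeftInvSubRiemannianMetric E G) (g : ℝ → G)
    (ψ : ∀ t, TangentSpace 𝓘(ℝ, E) (g t) →L[ℝ] ℝ) (u : ℝ → m.horizontal) : Prop where
  extremal : m.IsExtremal g ψ u
  normal : 0 < m.maxHamiltonian (g 0) (ψ 0)

end LeftInvSubRiemannianMetric

end

/-! Write `h_w(t) = ψ(t)(dl_{g(t)} w)` for the momentum component along `w ∈ 𝔤`. In a chart the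
Hamiltonian is `H = p (X_w x)`, with `X_w` the left-invariant field, so the Hamiltonian system reads
`ẋ = X_u`, `ṗ = -p ∘ DX_u`. The product rule gives `d/dt p(X_w) = p(DX_w X_u - DX_u X_w)`, that is,
`ḣ_w = h_{[u,w]}` almost everywhere (`ae_hasDerivAt_hamiltonian`).

On the unit ball of `𝔭`, Cauchy-Schwarz gives the maximum `M = √(∑ h_{e_i}²)`, and its equality case
forces `M u = ∑ h_{e_i} e_i` (`maxHamiltonian_smul_eq_sum`). Hence `(M²)˙ = 2 ∑ h_{e_i} h_{[u,e_i]}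
= 2 h_{[u, M u]} = 0`, and `M` keeps its positive initial value `M₀`. Dividing, `u = ∑ ψ_i e_i`
almost everywhere.

The right-hand side is continuous, so the derivatives of `g` and of the `h_w` agree almost
everywhere with continuous functions. For absolutely continuous curves the equations then hold at
every time (`hasDerivAt_of_ae`). Expanding `[e_i, e_j]` in the basis yields the structure constants.
-/

section NormalGeodesics

open Set Filter Topology

/-! ### Absolutely continuous curves -/

section AbsolutelyContinuous

/-- A locally Lipschitz function of an absolutely continuous curve is absolutely continuous. -/
lemma LocallyLipschitzOn.comp_absolutelyContinuousOnInterval {X Y : Type*} [PseudoMetricSpace X]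
    [PseudoMetricSpace Y] {Φ : X → Y} {f : ℝ → X} {s : Set X} {a b : ℝ}
    (hΦ : LocallyLipschitzOn s Φ) (hf : AbsolutelyContinuousOnInterval f a b)
    (hfs : MapsTo f (uIcc a b) s) (hc : ContinuousOn f (uIcc a b)) :
    AbsolutelyContinuousOnInterval (fun t ↦ Φ (f t)) a b := by
  obtain ⟨K, hK⟩ := (hΦ.mono hfs.image_subset).exists_lipschitzOnWith_of_compact
    (isCompact_uIcc.image_of_continuousOn hc)
  rw [absolutelyContinuousOnInterval_iff] at hf ⊢
  intro ε hε
  -- The Lipschitz constant `K` may be zero, hence `K + 1`.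
  obtain ⟨δ, hδ, h⟩ := hf (ε / (K + 1)) (by positivity)
  refine ⟨δ, hδ, fun I hI hIδ ↦ ?_⟩
  have hle : ∑ i ∈ Finset.range I.1, dist (Φ (f (I.2 i).1)) (Φ (f (I.2 i).2)) ≤
      K * ∑ i ∈ Finset.range I.1, dist (f (I.2 i).1) (f (I.2 i).2) := by
    rw [Finset.mul_sum]
    exact Finset.sum_le_sum fun i hi ↦ hK.dist_le_mul _ (mem_image_of_mem _ (hI.1 i hi).1) _
      (mem_image_of_mem _ (hI.1 i hi).2)
  have hlt := h I hI hIδ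
  rw [lt_div_iff₀ (by positivity)] at hlt
  have : 0 ≤ ∑ i ∈ Finset.range I.1, dist (f (I.2 i).1) (f (I.2 i).2) :=
    Finset.sum_nonneg fun _ _ ↦ dist_nonneg
  nlinarith

variable {E F : Type*} [NormedAddCommGroup E] [NormedSpace ℝ E] [NormedAddCommGroup F]
  [NormedSpace ℝ F]

/-- A map that is `C¹` at a point is Lipschitz near it; compactness of the image of the curve makes
the constant uniform. -/
lemma AbsolutelyContinuousOnInterval.contDiffAt_comp {Φ : E → F} {f : ℝ → E} {a b : ℝ}
    (hf : AbsolutelyContinuousOnInterval f a b)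
    (hΦ : ∀ t ∈ uIcc a b, ContDiffAt ℝ 1 Φ (f t)) :
    AbsolutelyContinuousOnInterval (fun t ↦ Φ (f t)) a b := by
  refine LocallyLipschitzOn.comp_absolutelyContinuousOnInterval
    (s := {x | ContDiffAt ℝ 1 Φ x}) (fun x hx ↦ ?_) hf hΦ hf.continuousOn
  obtain ⟨K, t, ht, hK⟩ := ContDiffAt.exists_lipschitzOnWith hx
  exact ⟨K, t, mem_nhdsWithin_of_mem_nhds ht, hK⟩

lemma AbsolutelyContinuousOnInterval.prodMk {f : ℝ → E} {g : ℝ → F} {a b : ℝ}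
    (hf : AbsolutelyContinuousOnInterval f a b) (hg : AbsolutelyContinuousOnInterval g a b) :
    AbsolutelyContinuousOnInterval (fun t ↦ (f t, g t)) a b := by
  have h1 : AbsolutelyContinuousOnInterval (fun t ↦ (f t, (0 : F))) a b :=
    hf.contDiffAt_comp (Φ := fun x ↦ (x, (0 : F))) fun _ _ ↦ by fun_prop
  have h2 : AbsolutelyContinuousOnInterval (fun t ↦ ((0 : E), g t)) a b :=
    hg.contDiffAt_comp (Φ := fun x ↦ ((0 : E), x)) fun _ _ ↦ by fun_prop
  simpa using h1.fun_add h2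

/-- An absolutely continuous function whose derivative agrees almost everywhere with a continuous
function is differentiable everywhere in the interior, with that derivative. -/
lemma AbsolutelyContinuousOnInterval.hasDerivAt_of_ae [CompleteSpace E] {f φ : ℝ → E} {a b : ℝ}
    (hf : AbsolutelyContinuousOnInterval f a b) (hφ : ContinuousOn φ (Icc a b))
    (hd : ∀ᵐ t ∂(volume : Measure ℝ), t ∈ Icc a b → HasDerivAt f (φ t) t)
    {t : ℝ} (ht : t ∈ Ioo a b) : HasDerivAt f (φ t) t := by
  have hab : a ≤ b := (ht.1.trans ht.2).le
  -- Extending `φ` by its endpoint values makes its primitive `C¹` on all of `ℝ`.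
  have hext : Continuous (IccExtend hab ((Icc a b).domRestrict φ)) :=
    hφ.domRestrict.Icc_extend'
  set χ := IccExtend hab ((Icc a b).domRestrict φ)
  have hχ : ∀ s ∈ Icc a b, χ s = φ s := fun s hs ↦ IccExtend_of_mem hab _ hs
  have hI : ∀ s, HasDerivAt (fun s ↦ ∫ x in a..s, χ x) (χ s) s := fun s ↦
    hext.integral_hasStrictDerivAt a s |>.hasDerivAt
  have hIc : ContDiff ℝ 1 (fun s ↦ ∫ x in a..s, χ x) := by
    rw [contDiff_one_iff_deriv]
    refine ⟨fun s ↦ (hI s).differentiableAt, ?_⟩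
    rwa [show deriv (fun s ↦ ∫ x in a..s, χ x) = χ from funext fun s ↦ (hI s).deriv]
  -- `f` minus this primitive is absolutely continuous with derivative zero almost everywhere, hence
  -- constant.
  obtain ⟨C, hC⟩ := (hf.fun_sub
    hIc.contDiffOn.absolutelyContinuousOnInterval).const_of_ae_hasDerivAt_zero (by
      filter_upwards [hd] with s hs hsab
      rw [uIcc_of_le hab] at hsab
      simpa [hχ s hsab] using! (hs hsab).fun_sub (hI s))
  rw [uIcc_of_le hab] at hC
  have heq : f =ᶠ[𝓝 t] fun s ↦ C + ∫ x in a..s, χ x := by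
    filter_upwards [Icc_mem_nhds ht.1 ht.2] with s hs
    rw [← hC s hs, sub_add_cancel]
  rw [← hχ t (Ioo_subset_Icc_self ht)]
  exact ((hI t).const_add C).congr_of_eventuallyEq heq

end AbsolutelyContinuous

/-! ### Cauchy-Schwarz on the unit ball -/

section UnitBall

lemma sum_mul_le_sqrt_of_sum_sq_le_one {ι : Type*} [Fintype ι] {α w : ι → ℝ}
    (hw : ∑ i, w i ^ 2 ≤ 1) : ∑ i, w i * α i ≤ √(∑ i, α i ^ 2) := by
  refine Real.le_sqrt_of_sq_le ?_
  calc _ ≤ (∑ i, w i ^ 2) * ∑ i, α i ^ 2 := Finset.sum_mul_sq_le_sq_mul_sq _ _ _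
    _ ≤ _ := mul_le_of_le_one_left (Finset.sum_nonneg fun _ _ ↦ sq_nonneg _) hw

/-- The equality case of the Cauchy-Schwarz inequality on the unit ball. -/
lemma sqrt_mul_eq_of_sum_mul_eq_sqrt {ι : Type*} [Fintype ι] {α w : ι → ℝ}
    (hw : ∑ i, w i ^ 2 ≤ 1) (h : ∑ i, w i * α i = √(∑ i, α i ^ 2)) (i : ι) :
    √(∑ i, α i ^ 2) * w i = α i := by
  set M := √(∑ i, α i ^ 2)
  have hM : M ^ 2 = ∑ i, α i ^ 2 := Real.sq_sqrt (Finset.sum_nonneg fun _ _ ↦ sq_nonneg _)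
  -- The sum of squares equals `M² ∑ w_i² - 2M² + M²`, which is at most zero since `∑ w_i² ≤ 1`.
  have key : ∑ i, (M * w i - α i) ^ 2 ≤ 0 := by
    have : ∑ i, (M * w i - α i) ^ 2 =
        M ^ 2 * ∑ i, w i ^ 2 - 2 * M * ∑ i, w i * α i + ∑ i, α i ^ 2 := by
      rw [Finset.mul_sum, Finset.mul_sum, ← Finset.sum_sub_distrib, ← Finset.sum_add_distrib]
      exact Finset.sum_congr rfl fun _ _ ↦ by ring
    rw [this, h, ← hM]
    nlinarith [sq_nonneg M]
  have h0 := (Finset.sum_eq_zero_iff_of_nonneg fun i _ ↦ sq_nonneg (M * w i - α i)).1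
    (key.antisymm (Finset.sum_nonneg fun _ _ ↦ sq_nonneg _)) i (Finset.mem_univ i)
  exact sub_eq_zero.1 (pow_eq_zero_iff two_ne_zero |>.1 h0)

/-- The convention `0⁻¹ = 0` covers `M = 0`, so that `M⁻¹ α` is an admissible maximiser even for
vanishing horizontal momentum. -/
lemma inv_mul_self_sq_le_one (M : ℝ) : (M⁻¹ * M) ^ 2 ≤ 1 := by
  rcases eq_or_ne M 0 with rfl | h
  · norm_num
  · rw [inv_mul_cancel₀ h, one_pow]

lemma inv_mul_sq_self (M : ℝ) : M⁻¹ * M ^ 2 = M := by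
  rcases eq_or_ne M 0 with rfl | h
  · norm_num
  · rw [sq, inv_mul_cancel_left₀ h]

end UnitBall

/-! ### Linearity of the Hamiltonian in the control -/

section HamiltonianLinear

variable {E : Type*} [NormedAddCommGroup E] [NormedSpace ℝ E]
  {G : Type*} [TopologicalSpace G] [ChartedSpace E G] [Group G]

lemma hamiltonian_add (g : G) (ξ : TangentSpace 𝓘(ℝ, E) g →L[ℝ] ℝ)
    (v w : GroupLieAlgebra 𝓘(ℝ, E) G) :
    hamiltonian g ξ (v + w) = hamiltonian g ξ v + hamiltonian g ξ w := by
  rw [hamiltonian, mulInvariantVectorField_add, Pi.add_apply, map_add]; rfl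

lemma hamiltonian_smul (g : G) (ξ : TangentSpace 𝓘(ℝ, E) g →L[ℝ] ℝ) (c : ℝ)
    (w : GroupLieAlgebra 𝓘(ℝ, E) G) : hamiltonian g ξ (c • w) = c * hamiltonian g ξ w := by
  rw [hamiltonian, mulInvariantVectorField_smul, Pi.smul_apply, map_smul]; rfl

/-- The Hamiltonian is linear in the control. -/
noncomputable def hamiltonianLinear (g : G) (ξ : TangentSpace 𝓘(ℝ, E) g →L[ℝ] ℝ) :
    GroupLieAlgebra 𝓘(ℝ, E) G →ₗ[ℝ] ℝ where
  toFun := hamiltonian g ξ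
  map_add' := hamiltonian_add g ξ
  map_smul' := hamiltonian_smul g ξ

@[simp] lemma hamiltonianLinear_apply (g : G) (ξ : TangentSpace 𝓘(ℝ, E) g →L[ℝ] ℝ)
    (w : GroupLieAlgebra 𝓘(ℝ, E) G) : hamiltonianLinear g ξ w = hamiltonian g ξ w := rfl

end HamiltonianLinear

/-! ### Maximising the Hamiltonian over the control region -/

namespace LeftInvSubRiemannianMetric

variable {E : Type*} [NormedAddCommGroup E] [NormedSpace ℝ E] [FiniteDimensional ℝ E]
  {G : Type*} [TopologicalSpace G] [ChartedSpace E G] [Group G] [LieGroup 𝓘(ℝ, E) ∞ G]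
  (m : LeftInvSubRiemannianMetric E G)
  {ι : Type*} [Fintype ι] {e : Module.Basis ι ℝ m.horizontal}

lemma hamiltonian_coe_eq_sum (e : Module.Basis ι ℝ m.horizontal) (g : G)
    (ξ : TangentSpace 𝓘(ℝ, E) g →L[ℝ] ℝ) (w : m.horizontal) :
    hamiltonian g ξ (w : GroupLieAlgebra 𝓘(ℝ, E) G) =
      ∑ i, e.repr w i * hamiltonian g ξ (e i : GroupLieAlgebra 𝓘(ℝ, E) G) := by
  have h := congrArg (hamiltonianLinear g ξ ∘ₗ m.horizontal.subtype) (e.sum_repr w)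
  rw [map_sum] at h
  simpa using h.symm

variable [DecidableEq ι]

lemma norm_eq_sqrt_sum_repr_sq (he : ∀ i j, m.scalar (e i) (e j) = if i = j then 1 else 0)
    (w : m.horizontal) : m.norm w = √(∑ i, e.repr w i ^ 2) := by
  rw [norm]
  congr 1
  have h : m.scalar (∑ i, e.repr w i • e i) (∑ i, e.repr w i • e i) = ∑ i, e.repr w i ^ 2 := by
    simp only [map_sum, map_smul, LinearMap.sum_apply, LinearMap.smul_apply, he, smul_eq_mul,
      mul_ite, mul_one, mul_zero, Finset.sum_ite_eq', Finset.mem_univ,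
      if_true, sq]
  rwa [e.sum_repr] at h

lemma mem_controlRegion_iff (he : ∀ i j, m.scalar (e i) (e j) = if i = j then 1 else 0)
    (w : m.horizontal) : w ∈ m.controlRegion ↔ ∑ i, e.repr w i ^ 2 ≤ 1 := by
  rw [controlRegion, mem_ofPred_eq, m.norm_eq_sqrt_sum_repr_sq he,
    Real.sqrt_le_iff]
  simp

lemma maxHamiltonian_eq_sqrt (he : ∀ i j, m.scalar (e i) (e j) = if i = j then 1 else 0)
    (g : G) (ξ : TangentSpace 𝓘(ℝ, E) g →L[ℝ] ℝ) :
    m.maxHamiltonian g ξ =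
      √(∑ i, hamiltonian g ξ (e i : GroupLieAlgebra 𝓘(ℝ, E) G) ^ 2) := by
  set α : ι → ℝ := fun i ↦ hamiltonian g ξ (e i : GroupLieAlgebra 𝓘(ℝ, E) G)
  set M := √(∑ i, α i ^ 2)
  have hM2 : M ^ 2 = ∑ i, α i ^ 2 := Real.sq_sqrt (Finset.sum_nonneg fun _ _ ↦ sq_nonneg _)
  -- The maximiser is the unit vector in the direction of `α`, or `0` when `α = 0`.
  refine IsGreatest.csSup_eq ⟨⟨∑ i, (M⁻¹ * α i) • e i, ?_, ?_⟩, ?_⟩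
  · rw [m.mem_controlRegion_iff he]
    simp only [e.repr_sum_self, mul_pow]
    rw [← Finset.mul_sum, ← hM2, ← mul_pow]
    exact inv_mul_self_sq_le_one M
  · refine (m.hamiltonian_coe_eq_sum e g ξ _).trans ?_
    rw [e.repr_sum_self]
    change ∑ i, M⁻¹ * α i * α i = M
    rw [show ∑ i, M⁻¹ * α i * α i = M⁻¹ * M ^ 2 by
      rw [hM2, Finset.mul_sum]; exact Finset.sum_congr rfl fun _ _ ↦ by ring]
    exact inv_mul_sq_self M
  · rintro _ ⟨w, hw, rfl⟩
    refine (m.hamiltonian_coe_eq_sum e g ξ w).trans_le ?_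
    exact sum_mul_le_sqrt_of_sum_sq_le_one ((m.mem_controlRegion_iff he w).1 hw)

/-- The control maximising the Hamiltonian is determined up to the factor `M`. -/
lemma maxHamiltonian_smul_eq_sum (he : ∀ i j, m.scalar (e i) (e j) = if i = j then 1 else 0)
    {g : G} {ξ : TangentSpace 𝓘(ℝ, E) g →L[ℝ] ℝ} {w : m.horizontal} (hw : w ∈ m.controlRegion)
    (h : hamiltonian g ξ (w : GroupLieAlgebra 𝓘(ℝ, E) G) = m.maxHamiltonian g ξ) :
    m.maxHamiltonian g ξ • w =
      ∑ i, hamiltonian g ξ (e i : GroupLieAlgebra 𝓘(ℝ, E) G) • e i := by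
  refine e.ext_elem fun i ↦ ?_
  rw [e.repr_sum_self, m.maxHamiltonian_eq_sqrt he, map_smul, Finsupp.smul_apply, smul_eq_mul]
  refine sqrt_mul_eq_of_sum_mul_eq_sqrt ((m.mem_controlRegion_iff he w).1 hw) ?_ i
  rw [← m.hamiltonian_coe_eq_sum e, h, m.maxHamiltonian_eq_sqrt he]

end LeftInvSubRiemannianMetric

/-! ### Left-invariant fields in a chart -/

section ChartField

open VectorField

variable {E : Type*} [NormedAddCommGroup E] [NormedSpace ℝ E]
  {G : Type*} [TopologicalSpace G] [ChartedSpace E G] [Group G]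

/-- The left-invariant vector field `dl_g w` in the preferred chart of `G` at `c`. -/
noncomputable def chartField (c : G) (w : GroupLieAlgebra 𝓘(ℝ, E) G) (x : E) : E :=
  mfderiv 𝓘(ℝ, E) 𝓘(ℝ, E) (extChartAt 𝓘(ℝ, E) c) ((extChartAt 𝓘(ℝ, E) c).symm x)
    (mulInvariantVectorField w ((extChartAt 𝓘(ℝ, E) c).symm x))

lemma chartField_add (c : G) (v w : GroupLieAlgebra 𝓘(ℝ, E) G) (x : E) :
    chartField c (v + w) x = chartField c v x + chartField c w x := by
  simp only [chartField]
  rw [mulInvariantVectorField_add, Pi.add_apply, map_add]; rfl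

lemma chartField_smul (c : G) (a : ℝ) (w : GroupLieAlgebra 𝓘(ℝ, E) G) (x : E) :
    chartField c (a • w) x = a • chartField c w x := by
  simp only [chartField]
  rw [mulInvariantVectorField_smul, Pi.smul_apply, map_smul]; rfl

variable [LieGroup 𝓘(ℝ, E) ∞ G]

/-- `chartField` pushes forward by `dφ`, whereas `mpullback` along `φ⁻¹` uses the inverse of
`d(φ⁻¹)`; this identifies the two. -/
lemma mfderiv_extChartAt_symm_inverse (c : G) {x : E} (hx : x ∈ (extChartAt 𝓘(ℝ, E) c).target) :
    (mfderiv 𝓘(ℝ, E) 𝓘(ℝ, E) (extChartAt 𝓘(ℝ, E) c).symm x).IsInvertible ∧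
    (mfderiv 𝓘(ℝ, E) 𝓘(ℝ, E) (extChartAt 𝓘(ℝ, E) c).symm x).inverse =
      mfderiv 𝓘(ℝ, E) 𝓘(ℝ, E) (extChartAt 𝓘(ℝ, E) c) ((extChartAt 𝓘(ℝ, E) c).symm x) := by
  have : IsManifold 𝓘(ℝ, E) 1 G := IsManifold.of_le (n := ∞) (by exact_mod_cast le_top)
  have h1 := mfderivWithin_extChartAt_symm_comp_mfderiv_extChartAt (I := 𝓘(ℝ, E)) hx
  have h2 := mfderiv_extChartAt_comp_mfderivWithin_extChartAt_symm (I := 𝓘(ℝ, E)) hx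
  simp only [modelWithCornersSelf_coe, range_id, mfderivWithin_univ] at h1 h2
  exact ⟨.of_inverse h1 h2, ContinuousLinearMap.inverse_eq h1 h2⟩

lemma mfderiv_symm_chartField (c : G) (w : GroupLieAlgebra 𝓘(ℝ, E) G) {x : E}
    (hx : x ∈ (extChartAt 𝓘(ℝ, E) c).target) :
    mfderiv 𝓘(ℝ, E) 𝓘(ℝ, E) (extChartAt 𝓘(ℝ, E) c).symm x (chartField (E := E) c w x) =
      mulInvariantVectorField w ((extChartAt 𝓘(ℝ, E) c).symm x) := by
  have : IsManifold 𝓘(ℝ, E) 1 G := IsManifold.of_le (n := ∞) (by exact_mod_cast le_top)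
  have h := mfderivWithin_extChartAt_symm_comp_mfderiv_extChartAt (I := 𝓘(ℝ, E)) hx
  simp only [modelWithCornersSelf_coe, range_id, mfderivWithin_univ] at h
  exact ContinuousLinearMap.ext_iff.1 h _

lemma chartField_eq_mpullback (c : G) (w : GroupLieAlgebra 𝓘(ℝ, E) G) {x : E}
    (hx : x ∈ (extChartAt 𝓘(ℝ, E) c).target) :
    chartField c w x = mpullback 𝓘(ℝ, E) 𝓘(ℝ, E) (extChartAt 𝓘(ℝ, E) c).symm
      (mulInvariantVectorField w) x := by
  rw [mpullback_apply, (mfderiv_extChartAt_symm_inverse c hx).2]; rfl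

lemma chartField_eventuallyEq (c : G) (w : GroupLieAlgebra 𝓘(ℝ, E) G) {x : E}
    (hx : x ∈ (extChartAt 𝓘(ℝ, E) c).target) :
    chartField c w =ᶠ[𝓝 x] mpullback 𝓘(ℝ, E) 𝓘(ℝ, E) (extChartAt 𝓘(ℝ, E) c).symm
      (mulInvariantVectorField w) := by
  filter_upwards [(isOpen_extChartAt_target c).mem_nhds hx] with y hy
  exact chartField_eq_mpullback c w hy

lemma contMDiffAt_extChartAt_symm_of_mem_target (c : G) {x : E}
    (hx : x ∈ (extChartAt 𝓘(ℝ, E) c).target) :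
    ContMDiffAt 𝓘(ℝ, E) 𝓘(ℝ, E) ∞ (extChartAt 𝓘(ℝ, E) c).symm x :=
  (contMDiffOn_extChartAt_symm c).contMDiffAt ((isOpen_extChartAt_target c).mem_nhds hx)

/-- The factor `(dφ)⁻¹` in the momentum coordinate cancels the `dφ` in the field. -/
lemma hamiltonian_eq_momentumCoord (c g : G) (hg : g ∈ (extChartAt 𝓘(ℝ, E) c).source)
    (ξ : TangentSpace 𝓘(ℝ, E) g →L[ℝ] ℝ) (w : GroupLieAlgebra 𝓘(ℝ, E) G) :
    hamiltonian g ξ w =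
      momentumCoord c g ξ (chartField c w (extChartAt 𝓘(ℝ, E) c g)) := by
  have : IsManifold 𝓘(ℝ, E) 1 G := IsManifold.of_le (n := ∞) (by exact_mod_cast le_top)
  have hinv := isInvertible_mfderiv_extChartAt (I := 𝓘(ℝ, E)) hg
  have h : chartField c w (extChartAt 𝓘(ℝ, E) c g) =
      mfderiv 𝓘(ℝ, E) 𝓘(ℝ, E) (extChartAt 𝓘(ℝ, E) c) g (mulInvariantVectorField w g) := by
    rw [chartField, (extChartAt 𝓘(ℝ, E) c).left_inv hg]
  rw [h, momentumCoord, hamiltonian]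
  exact congrArg ξ (hinv.inverse_apply_eq.2 rfl).symm

variable [CompleteSpace E]

lemma contDiffAt_chartField (c : G) (w : GroupLieAlgebra 𝓘(ℝ, E) G) {x : E}
    (hx : x ∈ (extChartAt 𝓘(ℝ, E) c).target) : ContDiffAt ℝ 1 (chartField c w) x := by
  have : IsManifold 𝓘(ℝ, E) 2 G := IsManifold.of_le (n := ∞) ENat.LEInfty.out
  refine ContDiffAt.congr_of_eventuallyEq ?_ (chartField_eventuallyEq c w hx)
  refine contMDiffAt_vectorSpace_iff_contDiffAt.1 ?_
  refine ContMDiffAt.mpullback_vectorField_preimage (n := 2) (m := 1) ?_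
    ((contMDiffAt_extChartAt_symm_of_mem_target c hx).of_le ENat.LEInfty.out)
    (mfderiv_extChartAt_symm_inverse c hx).1 (by norm_num)
  exact (contMDiffAt_mulInvariantVectorField w).of_le
    (le_trans (by norm_num) le_minSmoothness)

/-- In a chart, the bracket of the Lie algebra is the commutator of left-invariant fields. -/
lemma fderiv_chartField_sub (c : G) (v w : GroupLieAlgebra 𝓘(ℝ, E) G) {x : E}
    (hx : x ∈ (extChartAt 𝓘(ℝ, E) c).target) :
    fderiv ℝ (chartField c w) x (chartField c v x) -
      fderiv ℝ (chartField c v) x (chartField c w x) = chartField c ⁅v, w⁆ x := by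
  have : IsManifold 𝓘(ℝ, E) (minSmoothness ℝ 3) G :=
    IsManifold.of_le (n := ∞) (by
      rw [minSmoothness_of_isRCLikeNormedField]; exact ENat.LEInfty.out)
  -- Pullback by a diffeomorphism commutes with brackets, and on the model space the manifold
  -- bracket is the usual commutator.
  have h := mpullback_mlieBracket (I := 𝓘(ℝ, E)) (I' := 𝓘(ℝ, E)) (n := minSmoothness ℝ 2)
    (f := (extChartAt 𝓘(ℝ, E) c).symm) (x₀ := x)
    (mdifferentiableAt_mulInvariantVectorField v) (mdifferentiableAt_mulInvariantVectorField w)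
    ((contMDiffAt_extChartAt_symm_of_mem_target c hx).of_le (by
      rw [minSmoothness_of_isRCLikeNormedField]; exact ENat.LEInfty.out)) le_rfl
  have h' := congrFun (mlieBracketWithin_eq_lieBracketWithin (s := univ)
    (V := mpullback 𝓘(ℝ, E) 𝓘(ℝ, E) (extChartAt 𝓘(ℝ, E) c).symm (mulInvariantVectorField v))
    (W := mpullback 𝓘(ℝ, E) 𝓘(ℝ, E) (extChartAt 𝓘(ℝ, E) c).symm (mulInvariantVectorField w))) x
  rw [mlieBracketWithin_univ, ← h, ← mulInvariantVector_mlieBracket,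
    ← GroupLieAlgebra.bracket_def] at h'
  refine (Filter.EventuallyEq.lieBracket_vectorField_eq (chartField_eventuallyEq c v hx)
    (chartField_eventuallyEq c w hx)).trans ?_
  refine (congrFun lieBracketWithin_univ x).symm.trans ?_
  exact h'.symm.trans (chartField_eq_mpullback c _ hx).symm

end ChartField

/-! ### Further facts on curves and derivatives -/

lemma AbsolutelyContinuousOnInterval.congr_on {X : Type*} [PseudoMetricSpace X] {f f' : ℝ → X}
    {a b : ℝ} (hf : AbsolutelyContinuousOnInterval f a b) (h : EqOn f f' (uIcc a b)) :
    AbsolutelyContinuousOnInterval f' a b := by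
  rw [absolutelyContinuousOnInterval_iff] at hf ⊢
  intro ε hε
  obtain ⟨δ, hδ, H⟩ := hf ε hε
  refine ⟨δ, hδ, fun I hI hIδ ↦ ?_⟩
  rw [← Finset.sum_congr rfl fun i hi ↦
    congrArg₂ dist (h (hI.1 i hi).1) (h (hI.1 i hi).2)]
  exact H I hI hIδ

lemma AbsolutelyContinuousOnInterval.fun_sum {ι F : Type*} [NormedAddCommGroup F]
    [NormedSpace ℝ F] {f : ι → ℝ → F} {a b : ℝ} (s : Finset ι)
    (hf : ∀ i ∈ s, AbsolutelyContinuousOnInterval (f i) a b) :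
    AbsolutelyContinuousOnInterval (fun t ↦ ∑ i ∈ s, f i t) a b := by
  classical
  induction s using Finset.induction_on with
  | empty =>
    simpa using (contDiff_const (c := (0 : F))).contDiffOn.absolutelyContinuousOnInterval
  | insert i s his ih =>
    simp only [Finset.sum_insert his]
    exact (hf i (Finset.mem_insert_self i s)).fun_add
      (ih fun j hj ↦ hf j (Finset.mem_insert_of_mem hj))

/-- In finite dimension, weak differentiability of a curve is differentiability. -/
lemma hasDerivAt_of_forall_dual {E : Type*} [NormedAddCommGroup E] [NormedSpace ℝ E]
    [FiniteDimensional ℝ E] {x : ℝ → E} {x' : E} {t : ℝ}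
    (h : ∀ q : E →L[ℝ] ℝ, HasDerivAt (fun s ↦ q (x s)) (q x') t) : HasDerivAt x x' t := by
  let L : E ≃L[ℝ] (Fin (Module.finrank ℝ E) → ℝ) := (Module.finBasis ℝ E).equivFunL
  have hL : HasDerivAt (fun s ↦ L (x s)) (L x') t :=
    hasDerivAt_pi.2 fun i ↦
      h (LinearMap.toContinuousLinearMap ((Module.finBasis ℝ E).coord i))
  simpa [Function.comp_def] using! (L.symm : _ →L[ℝ] E).hasFDerivAt.comp_hasDerivAt t hL

lemma ContinuousLinearMap.comp_one_smulRight {E F : Type*} [NormedAddCommGroup E]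
    [NormedSpace ℝ E] [NormedAddCommGroup F] [NormedSpace ℝ F] {T : E →L[ℝ] F} {y : E} {z : F}
    (h : T y = z) :
    T ∘L (1 : ℝ →L[ℝ] ℝ).smulRight y = (1 : ℝ →L[ℝ] ℝ).smulRight z := by
  ext
  simp [h]

/-! ### Evolution of the momentum components -/

namespace IsHamiltonianTrajectory

variable {E : Type*} [NormedAddCommGroup E] [NormedSpace ℝ E]
  {G : Type*} [TopologicalSpace G] [ChartedSpace E G] [Group G]
  {g : ℝ → G} {ψ : ∀ t, TangentSpace 𝓘(ℝ, E) (g t) →L[ℝ] ℝ}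
  {u : ℝ → GroupLieAlgebra 𝓘(ℝ, E) G} {c : G} {a b : ℝ}

/-- The Hamiltonian system is given only on intervals spent in one chart; every time is interior to
such an interval. -/
lemma exists_Icc_mem_source (h : IsHamiltonianTrajectory g ψ u) (t : ℝ) :
    ∃ a b, t ∈ Ioo a b ∧ ∀ s ∈ Icc a b, g s ∈ (extChartAt 𝓘(ℝ, E) (g t)).source := by
  obtain ⟨ε, hε, hs⟩ := Metric.nhds_basis_closedBall.mem_iff.1
    (h.1.continuousAt.preimage_mem_nhds (extChartAt_source_mem_nhds (I := 𝓘(ℝ, E)) (g t)))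
  rw [Real.closedBall_eq_Icc] at hs
  exact ⟨t - ε, t + ε, ⟨by linarith, by linarith⟩, fun s h ↦ hs h⟩

variable [FiniteDimensional ℝ E]

lemma ae_hasDerivAt_chart (h : IsHamiltonianTrajectory g ψ u) (hab : a ≤ b)
    (hc : ∀ t ∈ Icc a b, g t ∈ (extChartAt 𝓘(ℝ, E) c).source) :
    ∀ᵐ t ∂(volume : Measure ℝ), t ∈ Icc a b →
      HasDerivAt (fun s ↦ extChartAt 𝓘(ℝ, E) c (g s))
        (chartField c (u t) (extChartAt 𝓘(ℝ, E) c (g t))) t := by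
  filter_upwards [(h.2 c a b hab hc).2.2] with t ht htab
  refine hasDerivAt_of_forall_dual fun q ↦ ?_
  have hq := (ht htab).1 q
  -- At fixed `x` the Hamiltonian is linear in `p`, namely evaluation at `X_u x`, hence its own
  -- derivative.
  have hlin : fderiv ℝ (fun p ↦ coordHamiltonian c (u t) (extChartAt 𝓘(ℝ, E) c (g t)) p)
      (momentumCoord c (g t) (ψ t)) =
      ContinuousLinearMap.apply ℝ ℝ (chartField c (u t) (extChartAt 𝓘(ℝ, E) c (g t))) :=
    (ContinuousLinearMap.apply ℝ ℝ
      (chartField c (u t) (extChartAt 𝓘(ℝ, E) c (g t)))).hasFDerivAt.fderiv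
  rw [hlin] at hq
  exact hq

variable [LieGroup 𝓘(ℝ, E) ∞ G]

lemma absolutelyContinuous_hamiltonian (h : IsHamiltonianTrajectory g ψ u) (hab : a ≤ b)
    (hc : ∀ t ∈ Icc a b, g t ∈ (extChartAt 𝓘(ℝ, E) c).source)
    (w : GroupLieAlgebra 𝓘(ℝ, E) G) :
    AbsolutelyContinuousOnInterval (fun t ↦ hamiltonian (g t) (ψ t) w) a b := by
  have := FiniteDimensional.complete ℝ E
  obtain ⟨hx, hp, -⟩ := h.2 c a b hab hc
  refine ((hp.prodMk hx).contDiffAt_comp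
    (Φ := fun z : (E →L[ℝ] ℝ) × E ↦ z.1 (chartField c w z.2)) fun t ht ↦ ?_).congr_on
    fun t ht ↦ ?_
  · rw [uIcc_of_le hab] at ht
    have h2 := ContDiffAt.comp (momentumCoord c (g t) (ψ t), extChartAt 𝓘(ℝ, E) c (g t))
      (contDiffAt_chartField c w ((extChartAt 𝓘(ℝ, E) c).map_source (hc t ht))) contDiffAt_snd
    exact contDiffAt_fst.clm_apply h2
  · rw [uIcc_of_le hab] at ht
    exact (hamiltonian_eq_momentumCoord c (g t) (hc t ht) (ψ t) w).symm

/-- The derivative of the component of the momentum along a left-invariant field. -/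
lemma ae_hasDerivAt_hamiltonian (h : IsHamiltonianTrajectory g ψ u) (hab : a ≤ b)
    (hc : ∀ t ∈ Icc a b, g t ∈ (extChartAt 𝓘(ℝ, E) c).source) :
    ∀ᵐ t ∂(volume : Measure ℝ), t ∈ Icc a b → ∀ w : GroupLieAlgebra 𝓘(ℝ, E) G,
      HasDerivAt (fun s ↦ hamiltonian (g s) (ψ s) w) (hamiltonian (g t) (ψ t) ⁅u t, w⁆) t := by
  have := FiniteDimensional.complete ℝ E
  filter_upwards [(h.2 c a b hab hc).2.2, h.ae_hasDerivAt_chart hab hc] with t ht hx htab w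
  have hp := (ht htab).2
  specialize hx htab
  have htgt := (extChartAt 𝓘(ℝ, E) c).map_source (hc t htab)
  have hd : ∀ v, DifferentiableAt ℝ (chartField c v) (extChartAt 𝓘(ℝ, E) c (g t)) := fun v ↦
    (contDiffAt_chartField c v htgt).differentiableAt one_ne_zero
  -- At fixed `p` the Hamiltonian is `p ∘ X_u`.
  have hfd : fderiv ℝ (fun x ↦ coordHamiltonian c (u t) x (momentumCoord c (g t) (ψ t)))
      (extChartAt 𝓘(ℝ, E) c (g t)) = (momentumCoord c (g t) (ψ t)).comp
        (fderiv ℝ (chartField c (u t)) (extChartAt 𝓘(ℝ, E) c (g t))) :=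
    ((momentumCoord c (g t) (ψ t)).hasFDerivAt.comp _ (hd (u t)).hasFDerivAt).fderiv
  rw [hfd] at hp
  have hF := (hd w).hasFDerivAt.comp_hasDerivAt t hx
  have heq : (fun s ↦ hamiltonian (g s) (ψ s) w) =ᶠ[𝓝 t] fun s ↦
      momentumCoord c (g s) (ψ s) (chartField c w (extChartAt 𝓘(ℝ, E) c (g s))) := by
    filter_upwards [h.1.continuousAt.preimage_mem_nhds
      ((isOpen_extChartAt_source c).mem_nhds (hc t htab))] with s hs
    exact hamiltonian_eq_momentumCoord c (g s) hs (ψ s) w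
  refine ((hp.clm_apply hF).congr_of_eventuallyEq heq).congr_deriv ?_
  rw [hamiltonian_eq_momentumCoord c (g t) (hc t htab), ← fderiv_chartField_sub c _ _ htgt,
    map_sub, sub_eq_neg_add]
  rfl

lemma continuous_hamiltonian (h : IsHamiltonianTrajectory g ψ u)
    (w : GroupLieAlgebra 𝓘(ℝ, E) G) : Continuous fun t ↦ hamiltonian (g t) (ψ t) w := by
  refine continuous_iff_continuousAt.2 fun t ↦ ?_
  obtain ⟨a, b, ht, hc⟩ := h.exists_Icc_mem_source t
  have hab := (ht.1.trans ht.2).le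
  have hcont := (h.absolutelyContinuous_hamiltonian hab hc w).continuousOn
  rw [uIcc_of_le hab] at hcont
  exact hcont.continuousAt (Icc_mem_nhds ht.1 ht.2)

/-- If the control is almost everywhere a continuous combination of fixed vectors, the momentum
components are differentiable everywhere. -/
lemma hasDerivAt_hamiltonian {ι : Type*} [Fintype ι] (h : IsHamiltonianTrajectory g ψ u)
    {α : ι → ℝ → ℝ} (hα : ∀ i, Continuous (α i)) (e : ι → GroupLieAlgebra 𝓘(ℝ, E) G)
    (hu : ∀ᵐ t ∂(volume : Measure ℝ), u t = ∑ i, α i t • e i)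
    (w : GroupLieAlgebra 𝓘(ℝ, E) G) (t : ℝ) :
    HasDerivAt (fun s ↦ hamiltonian (g s) (ψ s) w)
      (∑ i, α i t * hamiltonian (g t) (ψ t) ⁅e i, w⁆) t := by
  have := FiniteDimensional.complete ℝ E
  obtain ⟨a, b, ht, hc⟩ := h.exists_Icc_mem_source t
  have hab := (ht.1.trans ht.2).le
  refine (h.absolutelyContinuous_hamiltonian hab hc w).hasDerivAt_of_ae
    (φ := fun t ↦ ∑ i, α i t * hamiltonian (g t) (ψ t) ⁅e i, w⁆)
    (continuous_finsetSum _ fun i _ ↦ (hα i).mul (h.continuous_hamiltonian _)).continuousOn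
    ?_ ht
  filter_upwards [hu, h.ae_hasDerivAt_hamiltonian hab hc] with s hus hs hsab
  refine (hs hsab w).congr_deriv ?_
  rw [hus, sum_lie, ← hamiltonianLinear_apply, map_sum]
  simp only [smul_lie, map_smul, hamiltonianLinear_apply, smul_eq_mul]

/-- If the control is almost everywhere a continuous combination of fixed vectors, the
trajectory is differentiable everywhere. -/
lemma hasMFDerivAt {ι : Type*} [Fintype ι] (h : IsHamiltonianTrajectory g ψ u)
    {α : ι → ℝ → ℝ} (hα : ∀ i, Continuous (α i)) (e : ι → GroupLieAlgebra 𝓘(ℝ, E) G)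
    (hu : ∀ᵐ t ∂(volume : Measure ℝ), u t = ∑ i, α i t • e i) (t : ℝ) :
    HasMFDerivAt 𝓘(ℝ, ℝ) 𝓘(ℝ, E) g t ((1 : ℝ →L[ℝ] ℝ).smulRight
      (mulInvariantVectorField (∑ i, α i t • e i) (g t))) := by
  have := FiniteDimensional.complete ℝ E
  have : IsManifold 𝓘(ℝ, E) 1 G := IsManifold.of_le (n := ∞) ENat.LEInfty.out
  obtain ⟨a, b, ht, hc⟩ := h.exists_Icc_mem_source t
  have hab := (ht.1.trans ht.2).le
  set c := g t
  set x : ℝ → E := fun s ↦ extChartAt 𝓘(ℝ, E) c (g s)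
  have htgt : ∀ s ∈ Icc a b, x s ∈ (extChartAt 𝓘(ℝ, E) c).target := fun s hs ↦
    (extChartAt 𝓘(ℝ, E) c).map_source (hc s hs)
  have hxac : AbsolutelyContinuousOnInterval x a b := (h.2 c a b hab hc).1
  have hxcont := hxac.continuousOn
  rw [uIcc_of_le hab] at hxcont
  have hF : ∀ w : GroupLieAlgebra 𝓘(ℝ, E) G, ContinuousOn (fun s ↦ chartField c w (x s))
      (Icc a b) := fun w s hs ↦
    (contDiffAt_chartField c w (htgt s hs)).continuousAt.comp_continuousWithinAt (hxcont s hs)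
  have hsum : ∀ s y, ∑ i, α i s • chartField c (e i) y = chartField c (∑ i, α i s • e i) y := by
    intro s y
    let T : GroupLieAlgebra 𝓘(ℝ, E) G →ₗ[ℝ] E :=
      { toFun := fun w ↦ chartField c w y
        map_add' := fun v w ↦ chartField_add c v w y
        map_smul' := fun r w ↦ chartField_smul c r w y }
    change ∑ i, α i s • T (e i) = T (∑ i, α i s • e i)
    rw [map_sum]
    simp only [map_smul]
  have hd : HasDerivAt x (chartField c (∑ i, α i t • e i) (x t)) t := by
    rw [← hsum]
    refine hxac.hasDerivAt_of_ae (φ := fun s ↦ ∑ i, α i s • chartField c (e i) (x s))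
      (continuousOn_finsetSum _ fun i _ ↦ (hα i).continuousOn.smul (hF (e i))) ?_ ht
    filter_upwards [hu, h.ae_hasDerivAt_chart hab hc] with s hus hs hsab
    rw [hsum, ← hus]
    exact hs hsab
  have htab := Ioo_subset_Icc_self ht
  have hleft : (extChartAt 𝓘(ℝ, E) c).symm (x t) = g t :=
    (extChartAt 𝓘(ℝ, E) c).left_inv (hc t htab)
  have hsymm := ((contMDiffAt_extChartAt_symm_of_mem_target c
    (htgt t htab)).mdifferentiableAt (by simp)).hasMFDerivAt
  have hcomp := HasMFDerivAt.comp t hsymm hd.hasFDerivAt.hasMFDerivAt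
  have heq : g =ᶠ[𝓝 t] (extChartAt 𝓘(ℝ, E) c).symm ∘ x := by
    filter_upwards [Icc_mem_nhds ht.1 ht.2] with s hs
    exact ((extChartAt 𝓘(ℝ, E) c).left_inv (hc s hs)).symm
  refine (hcomp.congr_of_eventuallyEq heq).congr_mfderiv ?_
  set w := ∑ i, α i t • e i
  -- The base points `φ⁻¹(x t)` and `g t` are only propositionally equal, so the vectors are
  -- compared in the model space `E`.
  have hcast : ∀ y : G, y = g t →
      (mulInvariantVectorField w y : E) = (mulInvariantVectorField w (g t) : E) := by
    rintro y rfl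
    rfl
  exact ContinuousLinearMap.comp_one_smulRight (E := E) (F := E)
    ((mfderiv_symm_chartField c w (htgt t htab)).trans (hcast _ hleft))

end IsHamiltonianTrajectory

/-! ### Conservation of the maximised Hamiltonian and the control -/

namespace LeftInvSubRiemannianMetric

variable {E : Type*} [NormedAddCommGroup E] [NormedSpace ℝ E] [FiniteDimensional ℝ E]
  {G : Type*} [TopologicalSpace G] [ChartedSpace E G] [Group G] [LieGroup 𝓘(ℝ, E) ∞ G]
  {m : LeftInvSubRiemannianMetric E G} {ι : Type*} [Fintype ι] [DecidableEq ι]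
  {e : Module.Basis ι ℝ m.horizontal}
  {g : ℝ → G} {ψ : ∀ t, TangentSpace 𝓘(ℝ, E) (g t) →L[ℝ] ℝ} {u : ℝ → m.horizontal}

/-- The maximised Hamiltonian is constant along an extremal. -/
lemma IsExtremal.maxHamiltonian_eq (h : m.IsExtremal g ψ u)
    (he : ∀ i j, m.scalar (e i) (e j) = if i = j then 1 else 0) (s t : ℝ) :
    m.maxHamiltonian (g s) (ψ s) = m.maxHamiltonian (g t) (ψ t) := by
  have := FiniteDimensional.complete ℝ E
  have htraj := h.hamiltonian_system
  let Q : ℝ → ℝ := fun s ↦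
    ∑ i, hamiltonian (g s) (ψ s) (e i : GroupLieAlgebra 𝓘(ℝ, E) G) ^ 2
  have hconst : IsLocallyConstant Q := by
    rw [IsLocallyConstant.iff_eventually_eq]
    intro t
    obtain ⟨a, b, ht, hc⟩ := htraj.exists_Icc_mem_source t
    have hab := (ht.1.trans ht.2).le
    have hac : AbsolutelyContinuousOnInterval Q a b :=
      AbsolutelyContinuousOnInterval.fun_sum _ fun i _ ↦
        (htraj.absolutelyContinuous_hamiltonian hab hc _).contDiffAt_comp
          (Φ := fun y ↦ y ^ 2) fun _ _ ↦ by fun_prop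
    obtain ⟨C, hC⟩ := hac.const_of_ae_hasDerivAt_zero (by
      filter_upwards [h.maximum, htraj.ae_hasDerivAt_hamiltonian hab hc] with s hmax hs hsab
      rw [uIcc_of_le hab] at hsab
      have hu := congrArg Subtype.val
        (m.maxHamiltonian_smul_eq_sum he (h.mem_region s) hmax)
      have hd := HasDerivAt.fun_sum (u := Finset.univ) fun i _ ↦
        (hs hsab (e i : GroupLieAlgebra 𝓘(ℝ, E) G)).fun_pow 2
      refine hd.congr_deriv ?_
      -- Apply `h_{[u,·]}` to `M u = ∑ h_{e_i} e_i`: the left side vanishes because `[u,u] = 0`.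
      have key := congrArg (fun z ↦ hamiltonianLinear (g s) (ψ s)
        ⁅(u s : GroupLieAlgebra 𝓘(ℝ, E) G), z⁆) hu
      simp only [Submodule.coe_smul, lie_smul, lie_self, smul_zero, map_zero,
        Submodule.coe_sum, lie_sum, map_sum, map_smul, hamiltonianLinear_apply,
        smul_eq_mul] at key
      calc _ = 2 * ∑ i, hamiltonian (g s) (ψ s) (e i : GroupLieAlgebra 𝓘(ℝ, E) G) *
            hamiltonian (g s) (ψ s) ⁅(u s : GroupLieAlgebra 𝓘(ℝ, E) G),
              (e i : GroupLieAlgebra 𝓘(ℝ, E) G)⁆ := by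
            rw [Finset.mul_sum]
            exact Finset.sum_congr rfl fun _ _ ↦ by push_cast; ring
        _ = 0 := by rw [← key, mul_zero])
    rw [uIcc_of_le hab] at hC
    filter_upwards [Icc_mem_nhds ht.1 ht.2] with s hs
    rw [hC s hs, hC t (Ioo_subset_Icc_self ht)]
  rw [m.maxHamiltonian_eq_sqrt he, m.maxHamiltonian_eq_sqrt he]
  exact congrArg Real.sqrt (hconst.apply_eq_of_preconnectedSpace s t)

/-- The control of a normal geodesic is the normalised horizontal part of the momentum. -/
lemma IsNormalGeodesic.ae_control_eq (h : m.IsNormalGeodesic g ψ u)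
    (he : ∀ i j, m.scalar (e i) (e j) = if i = j then 1 else 0) :
    ∀ᵐ t ∂(volume : Measure ℝ), u t = ∑ i,
      (hamiltonian (g t) (ψ t) (e i : GroupLieAlgebra 𝓘(ℝ, E) G) /
        m.maxHamiltonian (g 0) (ψ 0)) • e i := by
  filter_upwards [h.extremal.maximum] with t ht
  have hu := m.maxHamiltonian_smul_eq_sum he (h.extremal.mem_region t) ht
  rw [h.extremal.maxHamiltonian_eq he t 0] at hu
  rw [← inv_smul_smul₀ h.normal.ne' (u t), hu, Finset.smul_sum]
  exact Finset.sum_congr rfl fun i _ ↦ by rw [smul_smul, div_eq_inv_mul]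

end LeftInvSubRiemannianMetric

end NormalGeodesics

/-- `ψc j` are the components, in the basis `b`, of the left-translated covector `ψ` normalised so
that the maximised Hamiltonian is `1`; `v t = ∑ i ≤ r, ψc i t • e i` is an element of `𝔭`. -/
theorem theorem5 {E : Type*} [NormedAddCommGroup E] [NormedSpace ℝ E] [FiniteDimensional ℝ E]
    {G : Type*} [TopologicalSpace G] [ChartedSpace E G] [Group G] [LieGroup 𝓘(ℝ, E) ∞ G]
    (m : LeftInvSubRiemannianMetric E G)
    {n r : ℕ} (hr : r ≤ n)
    (b : Module.Basis (Fin n) ℝ (GroupLieAlgebra 𝓘(ℝ, E) G))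
    (e : Module.Basis (Fin r) ℝ m.horizontal)
    (he : ∀ i j, m.scalar (e i) (e j) = if i = j then 1 else 0)
    (hbe : ∀ i : Fin r, b (Fin.castLE hr i) = (e i : GroupLieAlgebra 𝓘(ℝ, E) G))
    (g : ℝ → G) (ψ : ∀ t, TangentSpace 𝓘(ℝ, E) (g t) →L[ℝ] ℝ) (u : ℝ → m.horizontal)
    (hg : m.IsNormalGeodesic g ψ u) (hg0 : g 0 = 1)
    (ψc : Fin n → ℝ → ℝ)
    (hψc : ∀ j t, ψc j t = hamiltonian (g t) (ψ t) (b j) / m.maxHamiltonian (g 0) (ψ 0))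
    (v : ℝ → m.horizontal)
    (hv : ∀ t, v t = ∑ i : Fin r, ψc (Fin.castLE hr i) t • e i) :
    (∀ t, HasMFDerivAt 𝓘(ℝ, ℝ) 𝓘(ℝ, E) g t
      ((1 : ℝ →L[ℝ] ℝ).smulRight
        (mulInvariantVectorField (v t : GroupLieAlgebra 𝓘(ℝ, E) G) (g t)))) ∧
    (∀ᵐ t ∂(volume : Measure ℝ), u t = v t) ∧
    m.norm (v 0) = 1 ∧
    (∀ j t, HasDerivAt (ψc j)
      (∑ k : Fin n, ∑ i : Fin r,
        b.repr ⁅b (Fin.castLE hr i), b j⁆ k * ψc (Fin.castLE hr i) t * ψc k t) t) ∧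
    (m.horizontal = ⊤ → r = n) := by
  have := FiniteDimensional.complete ℝ E
  have htraj := hg.extremal.hamiltonian_system
  have hM := hg.normal
  have huv : ∀ᵐ t ∂(volume : Measure ℝ), u t = v t := by
    filter_upwards [hg.ae_control_eq he] with t ht
    simp only [ht, hv, hψc, hbe]
  have hvcoe : ∀ t, (v t : GroupLieAlgebra 𝓘(ℝ, E) G) =
      ∑ i, ψc (Fin.castLE hr i) t • (e i : GroupLieAlgebra 𝓘(ℝ, E) G) := fun t ↦ by
    rw [hv, Submodule.coe_sum]; rfl
  have hcoe : ∀ᵐ t ∂(volume : Measure ℝ), (u t : GroupLieAlgebra 𝓘(ℝ, E) G) =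
      ∑ i, ψc (Fin.castLE hr i) t • (e i : GroupLieAlgebra 𝓘(ℝ, E) G) := by
    filter_upwards [huv] with t ht
    rw [ht, hvcoe]
  have hcont : ∀ j, Continuous (ψc j) := fun j ↦ by
    rw [funext (hψc j)]
    exact (htraj.continuous_hamiltonian _).div_const _
  refine ⟨fun t ↦ ?_, huv, ?_, fun j t ↦ ?_, fun htop ↦ ?_⟩
  · rw [hvcoe]
    exact htraj.hasMFDerivAt (fun i ↦ hcont (Fin.castLE hr i))
      (fun i ↦ (e i : GroupLieAlgebra 𝓘(ℝ, E) G)) hcoe t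
  · rw [m.norm_eq_sqrt_sum_repr_sq he, hv, e.repr_sum_self]
    simp only [hψc, hbe, div_pow]
    rw [← Finset.sum_div, Real.sqrt_div' _ (sq_nonneg _), Real.sqrt_sq hM.le,
      ← m.maxHamiltonian_eq_sqrt he, div_self hM.ne']
  -- The coefficients `ψ_i` are already normalised; the single division by `M₀` normalises the
  -- remaining factor `h_{[e_i,e_j]}`, whose expansion gives the `ψ_k`.
  · have hd := (htraj.hasDerivAt_hamiltonian (fun i ↦ hcont (Fin.castLE hr i))
      (fun i ↦ (e i : GroupLieAlgebra 𝓘(ℝ, E) G)) hcoe (b j) t).div_const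
      (m.maxHamiltonian (g 0) (ψ 0))
    rw [← funext (hψc j)] at hd
    refine hd.congr_deriv ?_
    rw [Finset.sum_comm, Finset.sum_div]
    refine Finset.sum_congr rfl fun i _ ↦ ?_
    have hexp := congrArg (hamiltonianLinear (g t) (ψ t))
      (b.sum_repr ⁅b (Fin.castLE hr i), b j⁆)
    simp only [map_sum, map_smul, hamiltonianLinear_apply, smul_eq_mul] at hexp
    rw [← hbe, ← hexp, mul_div_assoc, Finset.sum_div, Finset.mul_sum]
    refine Finset.sum_congr rfl fun k _ ↦ ?_
    rw [hψc k]
    ring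
  · have h1 := Module.finrank_eq_card_basis e
    have h2 := Module.finrank_eq_card_basis b
    rw [htop, finrank_top, h2] at h1
    simpa using h1.symm
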